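/- Let $n\ge 0$. Let $V\in C^\infty(\mathbb R\times\mathbb R^n;\mathbb R)$ and $\phi_0\in C^\infty(\mathbb R^n;\mathbb R)$ be subquadratic in the space variable, in the following sense: for every multi-index $\alpha\in\mathbb N^n$ with $|\alpha|\ge 2$, $$\partial_x^\alpha V\in L^\infty_{\rm loc}\big(\mathbb R_t;L^\infty(\mathbb R^n_x)\big),\qquad \partial_x^\alpha\phi_0\in L^\infty(\mathbb R^n),$$ that is, $\partial_x^\alpha\phi_0$ is bounded on $\mathbb R^n$ and $\partial_x^\alpha V$ is bounded on $K\times\mathbb R^n$ for every compact $K\subset\mathbb R$. Then there exists $T>0$ such that the eikonal equation $$\partial_t\phi+\tfrac12|\nabla_x\phi|^2+V(t,x)=0\quad\text{on }[0,T]\times\mathbb R^n,\qquad \phi(0,x)=\phi_0(x)\ \text{ for all } x\in\mathbb R^n,$$ has exactly one real-valued solution $\phi\in C^\infty([0,T]\times\mathbb R^n)$ (smooth up to $t=0$ and $t=T$, with one-sided time derivatives there). Moreover, this solution is subquadratic: $\partial_x^\alpha\phi\in L^\infty([0,T]\times\mathbb R^n)$ for every multi-index $\alpha$ with $|\alpha|\ge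 2$. -/

import Mathlib

open scoped ContDiff Gradient

/-- `f : ℝⁿ → ℝ` is subquadratic: all its derivatives of order at least two are bounded on `ℝⁿ`.
The norm of the `k`-th Fréchet derivative is comparable to the maximum of the `|∂^α f|`
with `|α| = k`, and for smooth `f` the essential supremum is the supremum. -/
def IsSubquadratic {n : ℕ} (f : EuclideanSpace ℝ (Fin n) → ℝ) : Prop :=
  ∀ k : ℕ, 2 ≤ k → ∃ C : ℝ, ∀ x, ‖iteratedFDeriv ℝ k f x‖ ≤ C

/-- `f(t, x)` is subquadratic in the space variable, uniformly for times `t ∈ K`: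
`∂_x^α f ∈ L^∞(K × ℝⁿ)` as soon as `|α| ≥ 2`. -/
def IsSubquadraticOn {n : ℕ} (K : Set ℝ) (f : ℝ → EuclideanSpace ℝ (Fin n) → ℝ) : Prop :=
  ∀ k : ℕ, 2 ≤ k → ∃ C : ℝ, ∀ t ∈ K, ∀ x, ‖iteratedFDeriv ℝ k (f t) x‖ ≤ C

/-- The potential `V(t, x)` and the initial phase `φ₀(x)` are smooth and subquadratic in space,
locally uniformly in time in the case of `V`. -/
structure GeometricAssumption {n : ℕ} (V : ℝ → EuclideanSpace ℝ (Fin n) → ℝ)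
    (φ₀ : EuclideanSpace ℝ (Fin n) → ℝ) : Prop where
  potential_smooth : ContDiff ℝ ∞ (fun p : ℝ × EuclideanSpace ℝ (Fin n) => V p.1 p.2)
  potential_subquadratic : ∀ K : Set ℝ, IsCompact K → IsSubquadraticOn K V
  phase_smooth : ContDiff ℝ ∞ φ₀
  phase_subquadratic : IsSubquadratic φ₀

/-- `φ ∈ C^∞([0,T] × ℝⁿ)` solves `∂_t φ + ½ |∇_x φ|² + V = 0` on `[0,T] × ℝⁿ` with `φ(0) = φ₀`.
Only the values of `φ` at times in `[0,T]` matter; the time derivative is one-sided at the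
endpoints. -/
structure IsEikonalSolution {n : ℕ} (V : ℝ → EuclideanSpace ℝ (Fin n) → ℝ)
    (φ₀ : EuclideanSpace ℝ (Fin n) → ℝ) (T : ℝ)
    (φ : ℝ → EuclideanSpace ℝ (Fin n) → ℝ) : Prop where
  smooth : ContDiffOn ℝ ∞ (fun p : ℝ × EuclideanSpace ℝ (Fin n) => φ p.1 p.2)
    (Set.Icc 0 T ×ˢ Set.univ)
  equation : ∀ t ∈ Set.Icc 0 T, ∀ x,
    derivWithin (fun s => φ s x) (Set.Icc 0 T) t + 1 / 2 * ‖∇ (φ t) x‖ ^ 2 + V t x = 0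
  initial : ∀ x, φ 0 x = φ₀ x

/-!
The eikonal equation is solved by characteristics, organised so that no flow of an ordinary
differential equation has to be constructed or inverted. Fix `t` and `x`, and look for the classical
trajectory which is at `x` at time `t` and which starts with momentum `∇ φ₀` at its (unknown) initial
position. With time rescaled to the unit interval, a path `z` determines its momentum
`ξ = ∇ φ₀ (z 0) - t ∫₀ˢ ∇ V`, and it is such a trajectory if and only if `z = x - t ∫ₛ¹ ξ`. As the
second derivatives of `V` and `φ₀` are bounded, this is a contraction in `C([0, 1], E)` for small
`|t|`, uniformly in `x`; its fixed point is `ray`.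

* Regularity. Superposition operators `z ↦ f ∘ z` are smooth on `C([0, 1], E)`
  (`contDiff_superpose`), so the implicit function theorem makes the ray a smooth function of
  `(t, x)` for `|t| < T` (`contDiffAt_fixedPoint`). Negative times are included, so that smoothness
  up to `t = 0` is automatic.
* The equation. The phase `φ (t, x)` is the action of the ray. By the first variation formula
  (`first_variation`) its differential is `⟨ξ 1, dx⟩ - (½ |ξ 1|² + V) dt`, which is the eikonal
  equation together with `∇ φ = ξ 1`.
* Bounds. The derivatives of order at least one of the ray with respect to `x` are bounded
  uniformly in `t`, by induction on the order in the differentiated fixed point equation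
  (`boundedDerivs_fixedPoint`). Hence so are those of `∇ φ = ξ 1`.
* Uniqueness. If `ψ` is any smooth solution, then along a ray the difference `δ = ∇ ψ - ξ` solves a
  linear equation `δ' = -t ∇² ψ δ` with `δ 0 = 0`, so it vanishes; then `ψ` grows along the ray at
  the rate of the Lagrangian and equals the action (`eq_action_of_eikonal`).
-/

/-! ### Superposition operators on spaces of continuous paths -/

section Superposition

universe u
variable {I : Type*} [TopologicalSpace I] [CompactSpace I]
variable {A E F : Type u} [NormedAddCommGroup A] [NormedSpace ℝ A]
  [NormedAddCommGroup E] [NormedSpace ℝ E] [NormedAddCommGroup F] [NormedSpace ℝ F]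

/-- The superposition (Nemytskii) operator `z ↦ f ∘ z` on continuous paths. -/
def superpose {f : E → F} (hf : Continuous f) (z : C(I, E)) : C(I, F) :=
  ⟨f ∘ z, hf.comp z.continuous⟩

omit [CompactSpace I] [NormedSpace ℝ E] [NormedSpace ℝ F] in
@[simp] lemma superpose_apply {f : E → F} (hf : Continuous f) (z : C(I, E)) (s : I) :
    superpose hf z s = f (z s) := rfl

omit [CompactSpace I] [NormedSpace ℝ E] [NormedSpace ℝ F] in
lemma continuous_superpose {f : E → F} (hf : Continuous f) :
    Continuous (superpose (I := I) hf) :=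
  ContinuousMap.continuous_postcomp (X := I) ⟨f, hf⟩

variable (I E F) in
/-- Pointwise application `(a, z) ↦ (s ↦ a s (z s))` of a path of operators to a path of vectors. -/
noncomputable def pointwiseApply : C(I, E →L[ℝ] F) →L[ℝ] C(I, E) →L[ℝ] C(I, F) :=
  LinearMap.mkContinuous₂
    (LinearMap.mk₂ ℝ (fun (a : C(I, E →L[ℝ] F)) (z : C(I, E)) =>
        (⟨fun s => a s (z s), a.continuous.clm_apply z.continuous⟩ : C(I, F)))
      (fun _ _ _ => by ext; simp) (fun _ _ _ => by ext; simp)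
      (fun _ _ _ => by ext; simp) (fun _ _ _ => by ext; simp)) 1
    (fun a z => by
      rw [ContinuousMap.norm_le _ (by positivity)]
      intro s
      rw [one_mul]
      exact (a s).le_of_opNorm_le_of_le (a.norm_coe_le_norm s) (z.norm_coe_le_norm s))

@[simp] lemma pointwiseApply_apply (a : C(I, E →L[ℝ] F)) (z : C(I, E)) (s : I) :
    pointwiseApply I E F a z s = a s (z s) := rfl

set_option maxSynthPendingDepth 3 in
lemma norm_pointwiseApply_le : ‖pointwiseApply I E F‖ ≤ 1 :=
  LinearMap.mkContinuous₂_norm_le _ zero_le_one _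

lemma hasFDerivAt_superpose {f : E → F} (hf : ContDiff ℝ 1 f) (z : C(I, E)) :
    HasFDerivAt (superpose hf.continuous)
      (pointwiseApply I E F (superpose (hf.continuous_fderiv one_ne_zero) z)) z := by
  rw [hasFDerivAt_iff_isLittleO_nhds_zero, Asymptotics.isLittleO_iff]
  intro c hc
  have hcont := (continuous_superpose (I := I) (hf.continuous_fderiv one_ne_zero)).continuousAt
    (x := z)
  obtain ⟨δ, hδ, H⟩ := Metric.continuousAt_iff.1 hcont c hc
  filter_upwards [Metric.ball_mem_nhds (0 : C(I, E)) hδ] with h hh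
  rw [mem_ball_zero_iff] at hh
  rw [ContinuousMap.norm_le _ (by positivity)]
  intro s
  -- The segment from `z s` to `z s + h s` consists of values at `s` of paths near `z`.
  have key : ∀ y ∈ segment ℝ (z s) (z s + h s), ‖fderiv ℝ f y - fderiv ℝ f (z s)‖ ≤ c := by
    intro y hy
    rw [segment_eq_image'] at hy
    obtain ⟨θ, hθ, rfl⟩ := hy
    have h1 : dist (z + θ • h) z < δ := by
      rw [dist_eq_norm, add_sub_cancel_left, norm_smul, Real.norm_of_nonneg hθ.1]
      exact lt_of_le_of_lt (mul_le_of_le_one_left (norm_nonneg _) hθ.2) hh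
    have h2 := (ContinuousMap.dist_apply_le_dist (f := superpose (hf.continuous_fderiv one_ne_zero)
      (z + θ • h)) (g := superpose (hf.continuous_fderiv one_ne_zero) z) s).trans (H h1).le
    rw [dist_eq_norm] at h2
    simpa using h2
  have := (convex_segment (𝕜 := ℝ) (z s) (z s + h s)).norm_image_sub_le_of_norm_hasFDerivWithin_le'
    (f := f) (f' := fderiv ℝ f) (φ := fderiv ℝ f (z s)) (C := c)
    (fun y _ => (hf.differentiable one_ne_zero y).hasFDerivAt.hasFDerivWithinAt) key
    (left_mem_segment ℝ _ _) (right_mem_segment ℝ _ _)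
  refine le_trans ?_ (this.trans ?_)
  · simp
  · rw [add_sub_cancel_left]
    exact mul_le_mul_of_nonneg_left (h.norm_coe_le_norm s) hc.le

lemma contDiff_superpose_nat (k : ℕ) : ∀ {F : Type u} [NormedAddCommGroup F] [NormedSpace ℝ F]
    {f : E → F} (hf : ContDiff ℝ k f), ContDiff ℝ k (superpose (I := I) hf.continuous) := by
  induction k with
  | zero =>
    intro F _ _ f hf
    exact contDiff_zero.2 (continuous_superpose hf.continuous)
  | succ k ih =>
    intro F _ _ f hf
    have h1 : ContDiff ℝ 1 f := hf.of_le (by exact_mod_cast Nat.le_add_left 1 k)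
    have h2 : ContDiff ℝ k (fderiv ℝ f) := hf.fderiv_right (by norm_cast)
    have := ((contDiff_succ_iff_hasFDerivAt (𝕜 := ℝ) (n := k)).2
      ⟨_, (pointwiseApply I E F).contDiff.comp (ih h2), fun z => hasFDerivAt_superpose h1 z⟩)
    exact_mod_cast this

lemma contDiff_superpose {f : E → F} (hf : ContDiff ℝ ∞ f) :
    ContDiff ℝ ∞ (superpose (I := I) hf.continuous) :=
  contDiff_infty.2 fun k => contDiff_superpose_nat k (hf.of_le (by exact_mod_cast le_top))

variable (I A E) in
/-- The pairing of two paths, as a continuous linear map. -/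
noncomputable def pathPair : C(I, A) × C(I, E) →L[ℝ] C(I, A × E) :=
  LinearMap.mkContinuous
    { toFun := fun p => p.1.prodMk p.2
      map_add' := fun _ _ => by ext <;> simp
      map_smul' := fun _ _ => by ext <;> simp } 1
    (fun p => by
      rw [ContinuousMap.norm_le _ (by positivity), one_mul]
      intro s
      exact max_le_max (p.1.norm_coe_le_norm s) (p.2.norm_coe_le_norm s))

@[simp] lemma pathPair_apply (p : C(I, A) × C(I, E)) (s : I) :
    pathPair I A E p s = (p.1 s, p.2 s) := rfl

set_option maxSynthPendingDepth 3 in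
/-- The derivatives of a superposition operator with frozen first argument are bounded by the
partial derivatives of the function which it superposes. -/
lemma norm_iteratedFDeriv_superpose_le (c : C(I, A)) {C : ℝ} (hC : 0 ≤ C) (k : ℕ) :
    ∀ {F : Type u} [NormedAddCommGroup F] [NormedSpace ℝ F] {g : A × E → F}
      (hg : ContDiff ℝ ∞ g)
      (_ : ∀ s e, ‖iteratedFDeriv ℝ k (fun e => g (c s, e)) e‖ ≤ C) (z : C(I, E)),
      ‖iteratedFDeriv ℝ k (fun z => superpose hg.continuous (pathPair I A E (c, z))) z‖ ≤ C := by
  induction k with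
  | zero =>
    intro F _ _ g hg H z
    rw [norm_iteratedFDeriv_zero, ContinuousMap.norm_le _ hC]
    intro s
    simpa using H s (z s)
  | succ k ih =>
    intro F _ _ g hg H z
    set g₂ : A × E → E →L[ℝ] F := fun p => (fderiv ℝ g p).comp (.inr ℝ A E) with hg₂
    have hg₂s : ContDiff ℝ ∞ g₂ := by
      have : ContDiff ℝ ∞ (fderiv ℝ g) := hg.fderiv_right (by simp)
      fun_prop
    have hpart : ∀ a e, HasFDerivAt (fun e => g (a, e)) (g₂ (a, e)) e := fun a e =>
      ((hg.differentiable (by simp)) (a, e)).hasFDerivAt.comp e (hasFDerivAt_prodMk_right a e)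
    have hD : fderiv ℝ (fun z : C(I, E) => superpose hg.continuous (pathPair I A E (c, z))) =
        fun z => pointwiseApply I E F (superpose hg₂s.continuous (pathPair I A E (c, z))) := by
      funext z
      have h1 := (hasFDerivAt_superpose (I := I) (hg.of_le (by simp)) (pathPair I A E (c, z)))
      have h2 := (pathPair I A E).hasFDerivAt.comp z (hasFDerivAt_prodMk_right c z)
      refine ((h1.comp z h2).congr_fderiv ?_).fderiv
      ext h s
      simp [hg₂]
    rw [← norm_iteratedFDeriv_fderiv, hD]
    have hs : ContDiff ℝ ∞ (fun z : C(I, E) => superpose hg₂s.continuous (pathPair I A E (c, z))) :=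
      (contDiff_superpose hg₂s).comp ((pathPair I A E).contDiff.comp (contDiff_prodMk_right c))
    have := (pointwiseApply I E F).norm_iteratedFDeriv_comp_left (n := k) (x := z) hs.contDiffAt
      (by exact_mod_cast le_top)
    refine this.trans ((mul_le_of_le_one_left (norm_nonneg _) norm_pointwiseApply_le).trans ?_)
    refine ih hg₂s (fun s e => ?_) z
    have he : (fun e => g₂ (c s, e)) = fderiv ℝ (fun e => g (c s, e)) :=
      funext fun e => (hpart (c s) e).fderiv.symm
    rw [he, norm_iteratedFDeriv_fderiv]
    exact H s e

end Superposition

/-! ### Integration of continuous paths -/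

section Integration

open Set unitInterval

variable {E : Type*} [NormedAddCommGroup E] [NormedSpace ℝ E]

/-- The parameter `s` of a path on `[0, 1]`, clamped to the unit interval. -/
noncomputable abbrev clamp (r : ℝ) : I := projIcc (0 : ℝ) 1 zero_le_one r

lemma clamp_of_mem {r : ℝ} (hr : r ∈ Icc (0 : ℝ) 1) : clamp r = ⟨r, hr⟩ := projIcc_of_mem _ hr

lemma clamp_coe (s : I) : clamp (s : ℝ) = s := projIcc_val _ s

omit [NormedSpace ℝ E] in
lemma continuous_clamp_comp (f : C(I, E)) : Continuous fun r : ℝ => f (clamp r) :=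
  f.continuous.comp continuous_projIcc

lemma hasDerivAt_integral_clamp [CompleteSpace E] (f : C(I, E)) (r : ℝ) :
    HasDerivAt (fun r => ∫ u in (0 : ℝ)..r, f (clamp u)) (f (clamp r)) r :=
  (continuous_clamp_comp f).integral_hasStrictDerivAt 0 r |>.hasDerivAt

variable (E) in
/-- The primitive `f ↦ (s ↦ ∫₀ˢ f)` of continuous paths on the unit interval. -/
noncomputable def primitive [CompleteSpace E] : C(I, E) →L[ℝ] C(I, E) :=
  LinearMap.mkContinuous
    { toFun := fun f => ⟨fun s => ∫ u in (0 : ℝ)..s, f (clamp u),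
        (continuous_iff_continuousAt.2 fun r => (hasDerivAt_integral_clamp f r).continuousAt).comp
          continuous_subtype_val⟩
      map_add' := fun f g => by
        ext s
        exact intervalIntegral.integral_add ((continuous_clamp_comp f).intervalIntegrable _ _)
          ((continuous_clamp_comp g).intervalIntegrable _ _)
      map_smul' := fun c f => by
        ext s
        exact intervalIntegral.integral_smul c _ } 1
    (fun f => by
      rw [ContinuousMap.norm_le _ (by positivity), one_mul]
      intro s
      have := intervalIntegral.norm_integral_le_of_norm_le_const (a := (0 : ℝ)) (b := s)
        (f := fun u => f (clamp u)) (C := ‖f‖) (fun u _ => f.norm_coe_le_norm _)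
      refine this.trans ?_
      rw [sub_zero, abs_of_nonneg s.2.1]
      exact mul_le_of_le_one_right (norm_nonneg _) s.2.2)

lemma norm_primitive_le [CompleteSpace E] : ‖primitive E‖ ≤ 1 :=
  LinearMap.mkContinuous_norm_le _ zero_le_one _

lemma primitive_apply [CompleteSpace E] (f : C(I, E)) (s : I) :
    primitive E f s = ∫ u in (0 : ℝ)..s, f (clamp u) := rfl

@[simp] lemma primitive_zero [CompleteSpace E] (f : C(I, E)) : primitive E f 0 = 0 := by
  simp [primitive_apply]

lemma hasDerivWithinAt_primitive [CompleteSpace E] (f : C(I, E)) {r : ℝ} (hr : r ∈ Icc (0 : ℝ) 1) :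
    HasDerivWithinAt (fun r => primitive E f (clamp r)) (f (clamp r)) (Icc 0 1) r := by
  refine (hasDerivAt_integral_clamp f r).hasDerivWithinAt.congr_of_mem (fun u hu => ?_) hr
  rw [primitive_apply, clamp_of_mem hu]

variable (E) in
/-- Constant paths, as a continuous linear map. -/
noncomputable def constPath : E →L[ℝ] C(I, E) :=
  LinearMap.mkContinuous
    { toFun := fun x => ContinuousMap.const I x
      map_add' := fun _ _ => rfl
      map_smul' := fun _ _ => rfl } 1
    (fun x => by
      rw [ContinuousMap.norm_le _ (by positivity), one_mul]
      exact fun _ => le_rfl)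

@[simp] lemma constPath_apply (x : E) (s : I) : constPath E x s = x := rfl

lemma norm_constPath_le : ‖constPath E‖ ≤ 1 :=
  LinearMap.mkContinuous_norm_le _ zero_le_one _

/-- Evaluation of paths at a point, as a continuous linear map. -/
noncomputable def evalPath (s : I) : C(I, E) →L[ℝ] E := ContinuousMap.evalCLM ℝ s

@[simp] lemma evalPath_apply (s : I) (f : C(I, E)) : evalPath s f = f s := rfl

lemma norm_evalPath_le (s : I) : ‖evalPath (E := E) s‖ ≤ 1 :=
  ContinuousLinearMap.opNorm_le_bound _ zero_le_one fun f => by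
    simpa using f.norm_coe_le_norm s

variable (E) in
/-- The primitive `f ↦ (s ↦ ∫ₛ¹ f)` of continuous paths on the unit interval. -/
noncomputable def backwardPrimitive [CompleteSpace E] : C(I, E) →L[ℝ] C(I, E) :=
  (constPath E).comp ((evalPath 1).comp (primitive E)) - primitive E

lemma backwardPrimitive_apply [CompleteSpace E] (f : C(I, E)) (s : I) :
    backwardPrimitive E f s = primitive E f 1 - primitive E f s := rfl

@[simp] lemma backwardPrimitive_one [CompleteSpace E] (f : C(I, E)) :
    backwardPrimitive E f 1 = 0 := by
  simp [backwardPrimitive_apply]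

lemma norm_backwardPrimitive_le [CompleteSpace E] : ‖backwardPrimitive E‖ ≤ 2 := by
  refine ContinuousLinearMap.opNorm_le_bound _ zero_le_two fun f => ?_
  rw [ContinuousMap.norm_le _ (by positivity)]
  intro s
  have h : ∀ s, ‖primitive E f s‖ ≤ ‖f‖ := fun s =>
    ((primitive E f).norm_coe_le_norm s).trans
      (((primitive E).le_of_opNorm_le norm_primitive_le f).trans_eq (one_mul _))
  rw [backwardPrimitive_apply]
  linarith [norm_sub_le (primitive E f 1) (primitive E f s), h 1, h s]

lemma hasDerivWithinAt_backwardPrimitive [CompleteSpace E] (f : C(I, E)) {r : ℝ}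
    (hr : r ∈ Icc (0 : ℝ) 1) :
    HasDerivWithinAt (fun r => backwardPrimitive E f (clamp r)) (-f (clamp r)) (Icc 0 1) r :=
  (hasDerivWithinAt_primitive f hr).const_sub _

/-- The fundamental theorem of calculus for `primitive`. -/
lemma primitive_one_eq_sub [CompleteSpace E] (f : C(I, E)) {g : ℝ → E}
    (hg : ∀ r ∈ Icc (0 : ℝ) 1, HasDerivWithinAt g (f (clamp r)) (Icc 0 1) r) :
    primitive E f 1 = g 1 - g 0 := by
  rw [primitive_apply]
  refine intervalIntegral.integral_eq_sub_of_hasDerivAt_of_le zero_le_one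
    (fun r hr => (hg r hr).continuousWithinAt)
    (fun r hr => (hg r (Ioo_subset_Icc_self hr)).hasDerivAt (Icc_mem_nhds hr.1 hr.2))
    ((continuous_clamp_comp f).intervalIntegrable _ _)

end Integration

/-! ### Smooth dependence of fixed points on parameters -/

section FixedPoint

open Filter Topology

variable {P X : Type*} [NormedAddCommGroup P] [NormedSpace ℝ P] [CompleteSpace P]
  [NormedAddCommGroup X] [NormedSpace ℝ X] [CompleteSpace X]

/-- A fixed point which is unique, and at which the map is infinitesimally contracting, depends
smoothly on the parameters. -/
lemma contDiffAt_fixedPoint {Φ : P × X → X} (hΦ : ContDiff ℝ ∞ Φ) {z : P → X} {p₀ : P}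
    (hz : z p₀ = Φ (p₀, z p₀)) (huniq : ∀ᶠ p in 𝓝 p₀, ∀ w, w = Φ (p, w) → w = z p)
    (hcontr : ‖(fderiv ℝ Φ (p₀, z p₀)).comp (.inr ℝ P X)‖ < 1) :
    ContDiffAt ℝ ∞ z p₀ := by
  set f : P × X → X := fun q => q.2 - Φ q with hf
  have hfs : ContDiffAt ℝ ∞ f (p₀, z p₀) := (contDiff_snd.sub hΦ).contDiffAt
  have hne : (∞ : WithTop ℕ∞) ≠ 0 := by simp
  have hD : (fderiv ℝ f (p₀, z p₀)).comp (.inr ℝ P X) =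
      1 - (fderiv ℝ Φ (p₀, z p₀)).comp (.inr ℝ P X) := by
    rw [hf, fderiv_fun_sub differentiableAt_snd (hΦ.differentiable hne _)]
    ext x
    simp [fderiv_snd]
  have hinv : ((fderiv ℝ f (p₀, z p₀)).comp (.inr ℝ P X)).IsInvertible := by
    rw [hD]
    refine ⟨ContinuousLinearEquiv.ofUnit (Units.oneSub _ hcontr), ?_⟩
    rfl
  refine (hfs.contDiffAt_implicitFunction hne hinv).congr_of_eventuallyEq ?_
  filter_upwards [huniq, hfs.eventually_apply_implicitFunction hne hinv] with p hp1 hp2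
  refine (hp1 _ ?_).symm
  have : f (p₀, z p₀) = 0 := by simp only [hf]; rw [← hz, sub_self]
  rw [this] at hp2
  exact sub_eq_zero.1 hp2

end FixedPoint

/-! ### Families of maps with uniformly bounded derivatives -/

section UniformBounds

open Finset Nat

variable {ι : Type*} {D E F G : Type*} [NormedAddCommGroup D] [NormedSpace ℝ D]
  [NormedAddCommGroup E] [NormedSpace ℝ E]
  [NormedAddCommGroup F] [NormedSpace ℝ F] [NormedAddCommGroup G] [NormedSpace ℝ G]

/-- A family of smooth maps whose derivatives of orders `1, …, N` are bounded, uniformly over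
the family. -/
def BoundedDerivs (N : ℕ) (f : ι → E → F) : Prop :=
  (∀ i, ContDiff ℝ ∞ (f i)) ∧
    ∀ k, 1 ≤ k → k ≤ N → ∃ C : ℝ, ∀ i x, ‖iteratedFDeriv ℝ k (f i) x‖ ≤ C

omit [NormedAddCommGroup E] [NormedSpace ℝ E] in
lemma exists_uniform_bound {N : ℕ} {a : ℕ → ι → E → ℝ}
    (h : ∀ k, 1 ≤ k → k ≤ N → ∃ C : ℝ, ∀ i x, a k i x ≤ C) :
    ∃ C : ℝ, 1 ≤ C ∧ ∀ k, 1 ≤ k → k ≤ N → ∀ i x, a k i x ≤ C := by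
  induction N with
  | zero => exact ⟨1, le_rfl, fun k h1 h2 => by omega⟩
  | succ N ih =>
    obtain ⟨C, hC, H⟩ := ih fun k h1 h2 => h k h1 (h2.trans (Nat.le_succ N))
    obtain ⟨C', H'⟩ := h (N + 1) (by omega) le_rfl
    refine ⟨max C C', hC.trans (le_max_left _ _), fun k h1 h2 i x => ?_⟩
    rcases h2.lt_or_eq with h2 | rfl
    · exact (H k h1 (by omega) i x).trans (le_max_left _ _)
    · exact (H' i x).trans (le_max_right _ _)

lemma iteratedFDeriv_sub_const {k : ℕ} (hk : 1 ≤ k) (g : F → G) (c : G) :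
    iteratedFDeriv ℝ k (fun y => g y - c) = iteratedFDeriv ℝ k g := by
  obtain ⟨m, rfl⟩ := Nat.exists_eq_add_of_le' hk
  have : fderiv ℝ (fun y => g y - c) = fderiv ℝ g := by
    funext y
    exact fderiv_sub_const c
  funext y
  rw [iteratedFDeriv_succ_eq_comp_right, iteratedFDeriv_succ_eq_comp_right, Function.comp_apply,
    Function.comp_apply, this]

lemma BoundedDerivs.comp {N : ℕ} {g : ι → F → G} {f : ι → E → F} (hg : BoundedDerivs N g)
    (hf : BoundedDerivs N f) : BoundedDerivs N (fun i x => g i (f i x)) := by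
  refine ⟨fun i => (hg.1 i).comp (hf.1 i), fun k h1 h2 => ?_⟩
  obtain ⟨C, hC1, hC⟩ := exists_uniform_bound hg.2
  obtain ⟨R, hR1, hR⟩ := exists_uniform_bound hf.2
  refine ⟨k ! * C * R ^ k, fun i x => ?_⟩
  -- Normalising `g i` to vanish at `f i x` supplies the missing bound of order zero.
  have hs : ContDiff ℝ ∞ (fun y => g i y - g i (f i x)) := (hg.1 i).sub contDiff_const
  have := norm_iteratedFDeriv_comp_le (n := k) hs (hf.1 i) (by exact_mod_cast le_top) x
    (C := C) (D := R) (fun j hj => ?_) (fun j hj1 hj2 => ?_)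
  · have he : (fun y => g i y - g i (f i x)) ∘ f i = fun y => g i (f i y) - g i (f i x) := rfl
    rw [he, iteratedFDeriv_sub_const h1 (fun y => g i (f i y))] at this
    exact this
  · rcases Nat.eq_zero_or_pos j with rfl | hj0
    · simpa using zero_le_one.trans hC1
    · rw [iteratedFDeriv_sub_const hj0]
      exact hC j hj0 (hj.trans h2) i _
  · exact (hR j hj1 (hj2.trans h2) i x).trans (le_self_pow₀ hR1 (by omega))

/-- Solutions of the affine fixed point equations `z = L x + H i z` with uniformly contracting
`H i` inherit the uniform derivative bounds of `H i`. Indeed `A = Dz` solves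
`A = L + DH(z) ∘ A`; in the Leibniz formula for `Dᵏ A`, the only term of top order in `A` is at most
`½ ‖Dᵏ A‖`. -/
lemma boundedDerivs_fixedPoint {H : ι → F → F} (hH : ∀ N, BoundedDerivs N H)
    (hcontr : ∀ i w, ‖fderiv ℝ (H i) w‖ ≤ 1 / 2) (L : E →L[ℝ] F) {z : ι → E → F}
    (hzs : ∀ i, ContDiff ℝ ∞ (z i)) (hz : ∀ i x, z i x = L x + H i (z i x)) (N : ℕ) :
    BoundedDerivs N z := by
  induction N with
  | zero => exact ⟨hzs, fun k h1 h2 => by omega⟩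
  | succ N ih =>
    refine ⟨hzs, fun k h1 h2 => ?_⟩
    rcases h2.lt_or_eq with h2 | rfl
    · exact ih.2 k h1 (by omega)
    -- bounds for `DH(z)` of orders `1, …, N` and for `Dz` of orders `0, …, N - 1`
    have hDH : BoundedDerivs N (fun i w => fderiv ℝ (H i) w) :=
      ⟨fun i => ((hH 0).1 i).fderiv_right (by simp), fun k _ _ => by
        obtain ⟨C, hC⟩ := (hH (k + 1)).2 (k + 1) (by omega) le_rfl
        exact ⟨C, fun i x => by rw [norm_iteratedFDeriv_fderiv]; exact hC i x⟩⟩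
    have hcomp := hDH.comp ih
    obtain ⟨C, hC1, hC⟩ := exists_uniform_bound hcomp.2
    obtain ⟨R, hR1, hR⟩ := exists_uniform_bound ih.2
    have hAs : ∀ i, ContDiff ℝ ∞ (fderiv ℝ (z i)) := fun i => (hzs i).fderiv_right (by simp)
    have hA : ∀ i, fderiv ℝ (z i) =
        fun x => (fun x => L + (ContinuousLinearMap.compL ℝ E F F) (fderiv ℝ (H i) (z i x))
          (fderiv ℝ (z i) x)) x := by
      intro i
      funext x
      have h1 : HasFDerivAt (fun x => L x + H i (z i x))
          (L + (fderiv ℝ (H i) (z i x)).comp (fderiv ℝ (z i) x)) x :=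
        L.hasFDerivAt.add ((((hH 0).1 i).differentiable (by simp) _).hasFDerivAt.comp x
          ((hzs i).differentiable (by simp) x).hasFDerivAt)
      have h2 : (fun x => L x + H i (z i x)) = z i := funext fun x => (hz i x).symm
      rw [h2] at h1
      exact h1.fderiv
    have hBs : ∀ i, ContDiff ℝ ∞ (fun x => (ContinuousLinearMap.compL ℝ E F F)
        (fderiv ℝ (H i) (z i x)) (fderiv ℝ (z i) x)) := fun i =>
      (hcomp.1 i).clm_comp (hAs i)
    refine ⟨2 * (‖L‖ + ∑ j ∈ range N, (N.choose (j + 1) : ℝ) * C * R), fun i x => ?_⟩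
    rw [← norm_iteratedFDeriv_fderiv]
    set T := ‖iteratedFDeriv ℝ N (fderiv ℝ (z i)) x‖ with hT
    have hbil := (ContinuousLinearMap.compL ℝ E F F).norm_iteratedFDeriv_le_of_bilinear_of_le_one
      (hcomp.1 i) (hAs i) x (n := N) (by exact_mod_cast le_top)
      (ContinuousLinearMap.norm_compL_le ℝ E F F)
    rw [Finset.sum_range_succ'] at hbil
    have hlow : ∑ j ∈ range N, ((N.choose (j + 1) : ℝ) *
          ‖iteratedFDeriv ℝ (j + 1) (fun x => fderiv ℝ (H i) (z i x)) x‖ *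
          ‖iteratedFDeriv ℝ (N - (j + 1)) (fderiv ℝ (z i)) x‖) ≤
        ∑ j ∈ range N, (N.choose (j + 1) : ℝ) * C * R := by
      refine Finset.sum_le_sum fun j hj => ?_
      rw [Finset.mem_range] at hj
      have e1 := hC (j + 1) (by omega) (by omega) i x
      have e2 := hR (N - (j + 1) + 1) (by omega) (by omega) i x
      rw [← norm_iteratedFDeriv_fderiv] at e2
      gcongr
    have htop : ‖iteratedFDeriv ℝ 0 (fun x => fderiv ℝ (H i) (z i x)) x‖ ≤ 1 / 2 := by
      rw [norm_iteratedFDeriv_zero]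
      exact hcontr i _
    have hTle : T ≤ ‖L‖ + ‖iteratedFDeriv ℝ N (fun x => (ContinuousLinearMap.compL ℝ E F F)
        (fderiv ℝ (H i) (z i x)) (fderiv ℝ (z i) x)) x‖ := by
      rw [hT]
      conv_lhs => rw [hA i]
      rw [fun_iteratedFDeriv_add_apply (contDiff_const.of_le le_top).contDiffAt
        ((hBs i).of_le (by exact_mod_cast le_top)).contDiffAt]
      refine (norm_add_le _ _).trans ?_
      gcongr
      rcases Nat.eq_zero_or_pos N with rfl | hN
      · simp
      · rw [iteratedFDeriv_const_of_ne hN.ne']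
        simp
    simp only [Nat.choose_zero_right, Nat.cast_one, one_mul, Nat.sub_zero] at hbil
    have h3 : ‖iteratedFDeriv ℝ 0 (fun x => fderiv ℝ (H i) (z i x)) x‖ * T ≤ 1 / 2 * T :=
      mul_le_mul_of_nonneg_right htop (norm_nonneg _)
    linarith

end UniformBounds

section Families

variable {ι : Type*} {E F G : Type*}
  [NormedAddCommGroup E] [NormedSpace ℝ E]
  [NormedAddCommGroup F] [NormedSpace ℝ F] [NormedAddCommGroup G] [NormedSpace ℝ G]

lemma boundedDerivs_clm (N : ℕ) (L : ι → E →L[ℝ] F) {C : ℝ} (hL : ∀ i, ‖L i‖ ≤ C) :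
    BoundedDerivs N (fun i x => L i x) := by
  refine ⟨fun i => (L i).contDiff, fun k h1 _ => ⟨max C 0, fun i x => ?_⟩⟩
  obtain ⟨m, rfl⟩ := Nat.exists_eq_add_of_le' h1
  have hD : fderiv ℝ (fun x => L i x) = fun _ => L i := funext fun x => (L i).fderiv
  rw [← norm_iteratedFDeriv_fderiv, hD]
  rcases Nat.eq_zero_or_pos m with rfl | hm
  · rw [norm_iteratedFDeriv_zero]
    exact (hL i).trans (le_max_left _ _)
  · simp [iteratedFDeriv_const_of_ne hm.ne']

lemma BoundedDerivs.add {N : ℕ} {f g : ι → E → F} (hf : BoundedDerivs N f)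
    (hg : BoundedDerivs N g) : BoundedDerivs N (fun i x => f i x + g i x) := by
  refine ⟨fun i => (hf.1 i).add (hg.1 i), fun k h1 h2 => ?_⟩
  obtain ⟨C, hC⟩ := hf.2 k h1 h2
  obtain ⟨C', hC'⟩ := hg.2 k h1 h2
  refine ⟨C + C', fun i x => ?_⟩
  rw [fun_iteratedFDeriv_add_apply ((hf.1 i).of_le (by exact_mod_cast le_top)).contDiffAt
    ((hg.1 i).of_le (by exact_mod_cast le_top)).contDiffAt]
  exact (norm_add_le _ _).trans (add_le_add (hC i x) (hC' i x))

end Families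

/-! ### The momentum along a path -/

section Momentum

open Set unitInterval

variable {E : Type} [NormedAddCommGroup E] [InnerProductSpace ℝ E] [CompleteSpace E]
  {V : ℝ → E → ℝ} {φ₀ : E → ℝ}

lemma contDiff_gradient (hφ : ContDiff ℝ ∞ φ₀) : ContDiff ℝ ∞ (∇ φ₀) :=
  (InnerProductSpace.toDual ℝ E).symm.contDiff.comp (hφ.fderiv_right (by simp))

lemma fderiv_eq_inner_gradient (f : E → ℝ) (x v : E) : fderiv ℝ f x v = inner ℝ (∇ f x) v :=
  (InnerProductSpace.toDual_symm_apply (𝕜 := ℝ)).symm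

lemma norm_iteratedFDeriv_gradient (f : E → ℝ) (k : ℕ) (x : E) :
    ‖iteratedFDeriv ℝ k (∇ f) x‖ = ‖iteratedFDeriv ℝ (k + 1) f x‖ := by
  rw [← norm_iteratedFDeriv_fderiv]
  exact (InnerProductSpace.toDual ℝ E).symm.norm_iteratedFDeriv_comp_left (fderiv ℝ f) x k

/-- The spatial gradient of a function on space-time. -/
noncomputable def spatialGradient (V : ℝ → E → ℝ) (p : ℝ × E) : E := ∇ (V p.1) p.2

omit [CompleteSpace E] in
lemma hasFDerivAt_slice (hV : ContDiff ℝ ∞ (fun p : ℝ × E => V p.1 p.2)) (t : ℝ) (x : E) :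
    HasFDerivAt (V t) ((fderiv ℝ (fun p : ℝ × E => V p.1 p.2) (t, x)).comp (.inr ℝ ℝ E)) x :=
  (hV.differentiable (by simp) (t, x)).hasFDerivAt.comp x (hasFDerivAt_prodMk_right t x)

lemma contDiff_spatialGradient (hV : ContDiff ℝ ∞ (fun p : ℝ × E => V p.1 p.2)) :
    ContDiff ℝ ∞ (spatialGradient V) := by
  have h1 : spatialGradient V = fun p => (InnerProductSpace.toDual ℝ E).symm
      ((fderiv ℝ (fun p : ℝ × E => V p.1 p.2) p).comp (.inr ℝ ℝ E)) := by
    funext p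
    rw [spatialGradient, gradient, (hasFDerivAt_slice hV p.1 p.2).fderiv]
  have h2 : ContDiff ℝ ∞ (fderiv ℝ (fun p : ℝ × E => V p.1 p.2)) := hV.fderiv_right (by simp)
  rw [h1]
  exact (InnerProductSpace.toDual ℝ E).symm.contDiff.comp (by fun_prop)

lemma fderiv_apply_eq (hV : ContDiff ℝ ∞ (fun p : ℝ × E => V p.1 p.2)) (p : ℝ × E) (τ : ℝ)
    (v : E) : fderiv ℝ (fun p : ℝ × E => V p.1 p.2) p (τ, v) =
      τ * fderiv ℝ (fun p : ℝ × E => V p.1 p.2) p (1, 0) + inner ℝ (spatialGradient V p) v := by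
  have h : ((τ, v) : ℝ × E) = τ • ((1, 0) : ℝ × E) + (0, v) := by simp
  rw [h, map_add, map_smul, smul_eq_mul, spatialGradient, ← fderiv_eq_inner_gradient,
    (hasFDerivAt_slice hV p.1 p.2).fderiv]
  rfl

variable (E) in
/-- The space-time path `s ↦ (t s, z s)`, as a continuous linear map of `(t, z)`. -/
noncomputable def spaceTimePath : ℝ × C(I, E) →L[ℝ] C(I, ℝ × E) :=
  (pathPair I ℝ E).comp
    (((ContinuousLinearMap.id ℝ ℝ).smulRight (⟨Subtype.val, continuous_subtype_val⟩ : C(I, ℝ))).prodMap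
      (ContinuousLinearMap.id ℝ C(I, E)))

omit [CompleteSpace E] in
@[simp] lemma spaceTimePath_apply (q : ℝ × C(I, E)) (s : I) :
    spaceTimePath E q s = (q.1 * s, q.2 s) := rfl

/-- The momentum along a path `z`, as prescribed by Newton's law: `q = (t, z)` stands for the path
with position `z s` at time `t s`; its initial momentum is `∇ φ₀ (z 0)`, and the force is `-∇ V`. -/
noncomputable def momentum (hV : ContDiff ℝ ∞ (fun p : ℝ × E => V p.1 p.2)) (φ₀ : E → ℝ)
    (q : ℝ × C(I, E)) : C(I, E) :=
  constPath E (∇ φ₀ (q.2 0)) -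
    q.1 • primitive E (superpose (contDiff_spatialGradient hV).continuous (spaceTimePath E q))

lemma contDiff_momentum (hV : ContDiff ℝ ∞ (fun p : ℝ × E => V p.1 p.2))
    (hφ : ContDiff ℝ ∞ φ₀) : ContDiff ℝ ∞ (momentum hV φ₀) := by
  have h1 : ContDiff ℝ ∞ (fun q : ℝ × C(I, E) => constPath E (∇ φ₀ (q.2 0))) :=
    have h0 : ContDiff ℝ ∞ (fun q : ℝ × C(I, E) => evalPath (0 : I) q.2) :=
      (evalPath (E := E) (0 : I)).contDiff.comp contDiff_snd
    (constPath E).contDiff.comp ((contDiff_gradient hφ).comp h0)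
  have h2 : ContDiff ℝ ∞ (fun q : ℝ × C(I, E) => primitive E
      (superpose (contDiff_spatialGradient hV).continuous (spaceTimePath E q))) :=
    (primitive E).contDiff.comp ((contDiff_superpose (contDiff_spatialGradient hV)).comp
      (spaceTimePath E).contDiff)
  exact h1.sub (contDiff_fst.smul h2)

/-- The momentum at frozen times in `[-1, 1]` has bounded derivatives with respect to the path. -/
lemma boundedDerivs_momentum (hV : ContDiff ℝ ∞ (fun p : ℝ × E => V p.1 p.2))
    (hVb : ∀ k, 2 ≤ k → ∃ C : ℝ, ∀ t ∈ Icc (-1 : ℝ) 1, ∀ x, ‖iteratedFDeriv ℝ k (V t) x‖ ≤ C)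
    (hφ : ContDiff ℝ ∞ φ₀)
    (hφb : ∀ k, 2 ≤ k → ∃ C : ℝ, ∀ x, ‖iteratedFDeriv ℝ k φ₀ x‖ ≤ C) (N : ℕ) :
    BoundedDerivs N (fun (t : Icc (-1 : ℝ) 1) z => momentum hV φ₀ ((t : ℝ), z)) := by
  have h1 : BoundedDerivs N (fun (_ : Icc (-1 : ℝ) 1) (z : C(I, E)) =>
      constPath E (∇ φ₀ (evalPath 0 z))) := by
    have e1 : BoundedDerivs N (fun (_ : Icc (-1 : ℝ) 1) (z : C(I, E)) => evalPath 0 z) :=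
      boundedDerivs_clm N (fun _ => evalPath (E := E) 0) fun _ => norm_evalPath_le 0
    have e2 : BoundedDerivs N (fun (_ : Icc (-1 : ℝ) 1) (x : E) => ∇ φ₀ x) := by
      refine ⟨fun _ => contDiff_gradient hφ, fun k hk _ => ?_⟩
      obtain ⟨C, hC⟩ := hφb (k + 1) (by omega)
      exact ⟨C, fun _ x => by rw [norm_iteratedFDeriv_gradient]; exact hC x⟩
    have e3 : BoundedDerivs N (fun (_ : Icc (-1 : ℝ) 1) (x : E) => constPath E x) :=
      boundedDerivs_clm N (fun _ => constPath E) fun _ => norm_constPath_le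
    exact e3.comp (e2.comp e1)
  have h2 : BoundedDerivs N (fun (t : Icc (-1 : ℝ) 1) (z : C(I, E)) =>
      superpose (contDiff_spatialGradient hV).continuous (spaceTimePath E ((t : ℝ), z))) := by
    refine ⟨fun t => (contDiff_superpose (contDiff_spatialGradient hV)).comp
      ((spaceTimePath E).contDiff.comp (contDiff_prodMk_right (t : ℝ))), fun k hk _ => ?_⟩
    obtain ⟨C, hC⟩ := hVb (k + 1) (by omega)
    have hC0 : 0 ≤ C := (norm_nonneg _).trans (hC 0 (by simp) 0)
    refine ⟨C, fun t z => norm_iteratedFDeriv_superpose_le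
      ((t : ℝ) • (⟨Subtype.val, continuous_subtype_val⟩ : C(I, ℝ))) hC0 k
      (contDiff_spatialGradient hV) (fun s e => ?_) z⟩
    refine (norm_iteratedFDeriv_gradient (V ((t : ℝ) * s)) k e).trans_le (hC _ ?_ e)
    have h3 : |(t : ℝ) * s| ≤ 1 := by
      rw [abs_mul]
      exact mul_le_one₀ (abs_le.2 t.2) (abs_nonneg _) (abs_le.2 ⟨by linarith [s.2.1], s.2.2⟩)
    exact abs_le.1 h3
  have h4 : BoundedDerivs N (fun (t : Icc (-1 : ℝ) 1) (f : C(I, E)) =>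
      (-(t : ℝ) • primitive E) f) :=
    boundedDerivs_clm N (fun t : Icc (-1 : ℝ) 1 => -(t : ℝ) • primitive E) (C := 1) fun t => by
      rw [norm_smul, norm_neg]
      exact mul_le_one₀ (abs_le.2 t.2) (norm_nonneg _) norm_primitive_le
  have h5 : (fun (t : Icc (-1 : ℝ) 1) z => momentum hV φ₀ ((t : ℝ), z)) =
      fun (t : Icc (-1 : ℝ) 1) z =>
      constPath E (∇ φ₀ (evalPath 0 z)) + (-(t : ℝ) • primitive E)
        (superpose (contDiff_spatialGradient hV).continuous (spaceTimePath E ((t : ℝ), z))) := by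
    funext t z
    rw [momentum, sub_eq_add_neg, smul_apply, neg_smul]
    rfl
  rw [h5]
  exact h1.add (h4.comp h2)
end Momentum

/-! ### Rays: classical trajectories as fixed points -/

section Rays

open Set unitInterval

variable {E : Type} [NormedAddCommGroup E] [InnerProductSpace ℝ E] [CompleteSpace E]
  {V : ℝ → E → ℝ} {φ₀ : E → ℝ}

/-- The displacement `s ↦ -t ∫ₛ¹ momentum`. The path `z` satisfies Hamilton's equations and
arrives at `x` at time `t` if and only if `z = x + displacement`. -/
noncomputable def displacement (hV : ContDiff ℝ ∞ (fun p : ℝ × E => V p.1 p.2)) (φ₀ : E → ℝ)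
    (t : ℝ) (z : C(I, E)) : C(I, E) :=
  -t • backwardPrimitive E (momentum hV φ₀ (t, z))

lemma contDiff_displacement (hV : ContDiff ℝ ∞ (fun p : ℝ × E => V p.1 p.2))
    (hφ : ContDiff ℝ ∞ φ₀) :
    ContDiff ℝ ∞ (fun q : ℝ × C(I, E) => displacement hV φ₀ q.1 q.2) := by
  have h : ContDiff ℝ ∞ (fun q : ℝ × C(I, E) => backwardPrimitive E (momentum hV φ₀ q)) :=
    (backwardPrimitive E).contDiff.comp (contDiff_momentum hV hφ)
  exact contDiff_fst.neg.smul h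

/-- `T` is so small that the displacement is a `½`-contraction at all times `|t| < T`. -/
def IsShortTime (hV : ContDiff ℝ ∞ (fun p : ℝ × E => V p.1 p.2)) (φ₀ : E → ℝ) (T : ℝ) : Prop :=
  ∀ t, |t| < T → ∀ z, ‖fderiv ℝ (displacement hV φ₀ t) z‖ ≤ 1 / 2

set_option maxSynthPendingDepth 3 in
lemma boundedDerivs_displacement (hV : ContDiff ℝ ∞ (fun p : ℝ × E => V p.1 p.2))
    (hVb : ∀ k, 2 ≤ k → ∃ C : ℝ, ∀ t ∈ Icc (-1 : ℝ) 1, ∀ x, ‖iteratedFDeriv ℝ k (V t) x‖ ≤ C)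
    (hφ : ContDiff ℝ ∞ φ₀)
    (hφb : ∀ k, 2 ≤ k → ∃ C : ℝ, ∀ x, ‖iteratedFDeriv ℝ k φ₀ x‖ ≤ C) (N : ℕ) :
    BoundedDerivs N (fun (t : Icc (-1 : ℝ) 1) z => displacement hV φ₀ t z) := by
  have h : BoundedDerivs N (fun (t : Icc (-1 : ℝ) 1) (f : C(I, E)) =>
      (-(t : ℝ) • backwardPrimitive E) f) :=
    boundedDerivs_clm N (fun t : Icc (-1 : ℝ) 1 => -(t : ℝ) • backwardPrimitive E) (C := 2)
      fun t => by
        rw [norm_smul, norm_neg]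
        calc ‖(t : ℝ)‖ * ‖backwardPrimitive E‖ ≤ 1 * 2 :=
              mul_le_mul (abs_le.2 t.2) norm_backwardPrimitive_le (norm_nonneg _) zero_le_one
          _ = 2 := one_mul 2
  exact h.comp (boundedDerivs_momentum hV hVb hφ hφb N)

set_option maxSynthPendingDepth 3 in
lemma exists_isShortTime (hV : ContDiff ℝ ∞ (fun p : ℝ × E => V p.1 p.2))
    (hVb : ∀ k, 2 ≤ k → ∃ C : ℝ, ∀ t ∈ Icc (-1 : ℝ) 1, ∀ x, ‖iteratedFDeriv ℝ k (V t) x‖ ≤ C)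
    (hφ : ContDiff ℝ ∞ φ₀)
    (hφb : ∀ k, 2 ≤ k → ∃ C : ℝ, ∀ x, ‖iteratedFDeriv ℝ k φ₀ x‖ ≤ C) :
    ∃ T : ℝ, 0 < T ∧ T ≤ 1 ∧ IsShortTime hV φ₀ T := by
  obtain ⟨C, hC⟩ := (boundedDerivs_momentum hV hVb hφ hφb 1).2 1 le_rfl le_rfl
  have hC0 : 0 ≤ C := (norm_nonneg _).trans (hC ⟨0, by simp⟩ 0)
  -- `backwardPrimitive` has norm at most `2`, so the displacement is `2 |t| C`-Lipschitz.
  refine ⟨min 1 (1 / (4 * (C + 1))), by positivity, min_le_left _ _, fun t ht z => ?_⟩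
  have ht1 : |t| ≤ 1 := ht.le.trans (min_le_left _ _)
  have ht2 : |t| ≤ 1 / (4 * (C + 1)) := ht.le.trans (min_le_right _ _)
  have hd : DifferentiableAt ℝ (fun z => momentum hV φ₀ (t, z)) z :=
    ((contDiff_momentum hV hφ).comp (contDiff_prodMk_right t)).differentiable (by simp) z
  have h1 : HasFDerivAt (displacement hV φ₀ t)
      (-t • (backwardPrimitive E).comp (fderiv ℝ (fun z => momentum hV φ₀ (t, z)) z)) z :=
    ((backwardPrimitive E).hasFDerivAt.comp z hd.hasFDerivAt).const_smul (-t)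
  have h2 : ‖fderiv ℝ (fun z => momentum hV φ₀ (t, z)) z‖ ≤ C := by
    have := hC ⟨t, abs_le.1 ht1⟩ z
    rwa [← zero_add 1, ← norm_iteratedFDeriv_fderiv, norm_iteratedFDeriv_zero] at this
  rw [h1.fderiv, norm_smul, norm_neg, Real.norm_eq_abs]
  calc |t| * ‖(backwardPrimitive E).comp (fderiv ℝ (fun z => momentum hV φ₀ (t, z)) z)‖
      ≤ 1 / (4 * (C + 1)) * (2 * C) := by
        gcongr
        exact (ContinuousLinearMap.opNorm_comp_le _ _).trans
          (mul_le_mul norm_backwardPrimitive_le h2 (norm_nonneg _) zero_le_two)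
    _ ≤ 1 / 2 := by
        rw [div_mul_eq_mul_div, div_le_div_iff₀ (by positivity) (by positivity)]
        linarith

/-- The path of the classical particle which is at `x` at time `t`, where `p = (t, x)`, and whose
initial momentum is `∇ φ₀` at its initial position. Time is rescaled to the unit interval. For large
`t` such a path need not exist or be unique, and the value is then arbitrary. -/
noncomputable def ray (hV : ContDiff ℝ ∞ (fun p : ℝ × E => V p.1 p.2)) (φ₀ : E → ℝ)
    (p : ℝ × E) : C(I, E) :=
  Classical.epsilon fun z => z = constPath E p.2 + displacement hV φ₀ p.1 z

variable {hV : ContDiff ℝ ∞ (fun p : ℝ × E => V p.1 p.2)} {T : ℝ}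

lemma IsShortTime.norm_displacement_sub_le (hT : IsShortTime hV φ₀ T) (hφ : ContDiff ℝ ∞ φ₀) {t : ℝ} (ht : |t| < T)
    (z w : C(I, E)) :
    ‖displacement hV φ₀ t z - displacement hV φ₀ t w‖ ≤ 1 / 2 * ‖z - w‖ :=
  convex_univ.norm_image_sub_le_of_norm_fderiv_le (𝕜 := ℝ)
    (fun y _ => ((contDiff_displacement hV hφ).comp (contDiff_prodMk_right t)).differentiable
      (by simp) y) (fun y _ => hT t ht y) (mem_univ _) (mem_univ _)

lemma IsShortTime.ray_eq (hT : IsShortTime hV φ₀ T) (hφ : ContDiff ℝ ∞ φ₀) {p : ℝ × E}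
    (hp : |p.1| < T) :
    ray hV φ₀ p = constPath E p.2 + displacement hV φ₀ p.1 (ray hV φ₀ p) := by
  have hc : ContractingWith (1 / 2)
      (fun z => constPath E p.2 + displacement hV φ₀ p.1 z) := by
    refine ⟨by rw [← NNReal.coe_lt_coe]; norm_num, LipschitzWith.of_dist_le_mul fun z w => ?_⟩
    rw [dist_add_left, dist_eq_norm, dist_eq_norm]
    simpa using hT.norm_displacement_sub_le hφ hp z w
  exact Classical.epsilon_spec (p := fun z => z = constPath E p.2 + displacement hV φ₀ p.1 z)
    ⟨_, hc.fixedPoint_isFixedPt.symm⟩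

lemma IsShortTime.eq_ray (hT : IsShortTime hV φ₀ T) (hφ : ContDiff ℝ ∞ φ₀) {p : ℝ × E}
    (hp : |p.1| < T) {z : C(I, E)} (hz : z = constPath E p.2 + displacement hV φ₀ p.1 z) :
    z = ray hV φ₀ p := by
  have h1 := hT.ray_eq hφ hp
  have h2 := hT.norm_displacement_sub_le hφ hp z (ray hV φ₀ p)
  have h3 : z - ray hV φ₀ p =
      displacement hV φ₀ p.1 z - displacement hV φ₀ p.1 (ray hV φ₀ p) := by
    conv_lhs => rw [hz, h1]
    abel
  rw [← h3] at h2
  have h4 : ‖z - ray hV φ₀ p‖ = 0 := by linarith [norm_nonneg (z - ray hV φ₀ p)]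
  exact sub_eq_zero.1 (norm_eq_zero.1 h4)

omit [InnerProductSpace ℝ E] [CompleteSpace E] in
lemma eventually_abs_fst_lt (p : ℝ × E) (hp : |p.1| < T) :
    ∀ᶠ q : ℝ × E in nhds p, |q.1| < T :=
  (continuous_fst.abs.continuousAt (x := p)).eventually_lt continuousAt_const hp

lemma IsShortTime.contDiffAt_ray (hT : IsShortTime hV φ₀ T) (hφ : ContDiff ℝ ∞ φ₀) {p : ℝ × E}
    (hp : |p.1| < T) : ContDiffAt ℝ ∞ (ray hV φ₀) p := by
  have hs : ContDiff ℝ ∞ (fun q : (ℝ × E) × C(I, E) =>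
      constPath E q.1.2 + displacement hV φ₀ q.1.1 q.2) := by
    have h1 : ContDiff ℝ ∞ (fun q : (ℝ × E) × C(I, E) => constPath E q.1.2) :=
      (constPath E).contDiff.comp (contDiff_snd.comp contDiff_fst)
    have h2 : ContDiff ℝ ∞ (fun q : (ℝ × E) × C(I, E) => displacement hV φ₀ q.1.1 q.2) :=
      (contDiff_displacement hV hφ).comp
        ((contDiff_fst.comp contDiff_fst).prodMk contDiff_snd)
    exact h1.add h2
  refine contDiffAt_fixedPoint hs (hT.ray_eq hφ hp) ?_ ?_
  · filter_upwards [eventually_abs_fst_lt p hp] with q hq w hw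
    exact hT.eq_ray hφ hq hw
  · have h3 := ((hs.differentiable (by simp)) (p, ray hV φ₀ p)).hasFDerivAt.comp (ray hV φ₀ p)
      (hasFDerivAt_prodMk_right p (ray hV φ₀ p))
    have h4 : fderiv ℝ (fun z => constPath E p.2 + displacement hV φ₀ p.1 z) (ray hV φ₀ p) =
        _ := h3.fderiv
    rw [← h4, fderiv_const_add]
    exact (hT p.1 hp _).trans_lt (by norm_num)

end Rays

/-! ### The action and its first variation -/

section Action

open Set unitInterval

variable {E : Type} [NormedAddCommGroup E] [InnerProductSpace ℝ E] [CompleteSpace E]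
  {V : ℝ → E → ℝ} {φ₀ : E → ℝ}

omit [CompleteSpace E] in
lemma contDiff_kinetic : ContDiff ℝ ∞ (fun v : E => 1 / 2 * ‖v‖ ^ 2) :=
  contDiff_const.mul (contDiff_norm_sq ℝ)

omit [CompleteSpace E] in
lemma hasFDerivAt_kinetic (v : E) :
    HasFDerivAt (fun v : E => 1 / 2 * ‖v‖ ^ 2) (innerSL ℝ v) v := by
  refine ((hasStrictFDerivAt_norm_sq v).hasFDerivAt.const_mul (1 / 2 : ℝ)).congr_fderiv ?_
  ext w
  simp

/-- The Lagrangian `½|ξ|² - V` along a path, where `ξ` is the momentum. -/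
noncomputable def lagrangian (hV : ContDiff ℝ ∞ (fun p : ℝ × E => V p.1 p.2)) (φ₀ : E → ℝ)
    (q : ℝ × C(I, E)) : C(I, ℝ) :=
  superpose (contDiff_kinetic (E := E)).continuous (momentum hV φ₀ q) -
    superpose hV.continuous (spaceTimePath E q)

/-- The action of a path: the initial phase at its starting point, plus the integral of the
Lagrangian. -/
noncomputable def action (hV : ContDiff ℝ ∞ (fun p : ℝ × E => V p.1 p.2)) (φ₀ : E → ℝ)
    (q : ℝ × C(I, E)) : ℝ :=
  φ₀ (q.2 0) + q.1 * primitive ℝ (lagrangian hV φ₀ q) 1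

/-- The action of rays, as a function of space-time. -/
noncomputable def phase (hV : ContDiff ℝ ∞ (fun p : ℝ × E => V p.1 p.2)) (φ₀ : E → ℝ)
    (p : ℝ × E) : ℝ :=
  action hV φ₀ (p.1, ray hV φ₀ p)

variable {hV : ContDiff ℝ ∞ (fun p : ℝ × E => V p.1 p.2)} {T : ℝ}

lemma contDiff_lagrangian (hφ : ContDiff ℝ ∞ φ₀) : ContDiff ℝ ∞ (lagrangian hV φ₀) :=
  ((contDiff_superpose contDiff_kinetic).comp (contDiff_momentum hV hφ)).sub
    ((contDiff_superpose hV).comp (spaceTimePath E).contDiff)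

lemma contDiff_action (hφ : ContDiff ℝ ∞ φ₀) : ContDiff ℝ ∞ (action hV φ₀) := by
  have h0 : ContDiff ℝ ∞ (fun q : ℝ × C(I, E) => evalPath (0 : I) q.2) :=
    (evalPath (E := E) (0 : I)).contDiff.comp contDiff_snd
  have h1 : ContDiff ℝ ∞ (fun q : ℝ × C(I, E) =>
      evalPath (1 : I) (primitive ℝ (lagrangian hV φ₀ q))) :=
    ((evalPath (E := ℝ) (1 : I)).comp (primitive ℝ)).contDiff.comp (contDiff_lagrangian hφ)
  exact (hφ.comp h0).add (contDiff_fst.mul h1)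

lemma lagrangian_apply (q : ℝ × C(I, E)) (s : I) :
    lagrangian hV φ₀ q s = 1 / 2 * ‖momentum hV φ₀ q s‖ ^ 2 - V (q.1 * s) (q.2 s) := rfl

lemma fderiv_lagrangian_apply (hφ : ContDiff ℝ ∞ φ₀) (q d : ℝ × C(I, E)) (s : I) :
    fderiv ℝ (lagrangian hV φ₀) q d s =
      inner ℝ (momentum hV φ₀ q s) (fderiv ℝ (momentum hV φ₀) q d s) -
        fderiv ℝ (fun p : ℝ × E => V p.1 p.2) (q.1 * s, q.2 s) (d.1 * s, d.2 s) := by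
  have hm := ((contDiff_momentum hV hφ).differentiable (by simp) q).hasFDerivAt
  have h1 := (hasFDerivAt_superpose ((contDiff_kinetic (E := E)).of_le (by simp))
    (momentum hV φ₀ q)).comp q hm
  have h2 := (hasFDerivAt_superpose (hV.of_le (by simp)) (spaceTimePath E q)).comp q
    (spaceTimePath E).hasFDerivAt
  have h3 : fderiv ℝ (lagrangian hV φ₀) q = _ := (h1.sub h2).fderiv
  rw [h3, ← innerSL_apply_apply ℝ, ← (hasFDerivAt_kinetic (momentum hV φ₀ q s)).fderiv]
  rfl

section FirstVariation

variable {t τ : ℝ} {x h : E} {z ζ μ : C(I, E)}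

lemma hasDerivWithinAt_momentum {r : ℝ} (hr : r ∈ Icc (0 : ℝ) 1) :
    HasDerivWithinAt (fun r => momentum hV φ₀ (t, z) (clamp r))
      (-t • spatialGradient V (t * r, z (clamp r))) (Icc 0 1) r := by
  have := ((hasDerivWithinAt_primitive (superpose (contDiff_spatialGradient hV).continuous
    (spaceTimePath E (t, z))) hr).const_smul t).const_sub (∇ φ₀ (z 0))
  rw [superpose_apply, spaceTimePath_apply, ← neg_smul] at this
  have hc : ((clamp r : I) : ℝ) = r := by rw [clamp_of_mem hr]
  simp only [hc] at this
  exact this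

lemma hasDerivWithinAt_path (hz : z = constPath E x + displacement hV φ₀ t z) {r : ℝ}
    (hr : r ∈ Icc (0 : ℝ) 1) :
    HasDerivWithinAt (fun r => z (clamp r)) (t • momentum hV φ₀ (t, z) (clamp r)) (Icc 0 1) r := by
  have := ((hasDerivWithinAt_backwardPrimitive (momentum hV φ₀ (t, z)) hr).const_smul (-t)).const_add
    x
  rw [neg_smul_neg] at this
  refine this.congr_of_mem (fun u _ => ?_) hr
  conv_lhs => rw [hz]
  rfl

lemma hasDerivWithinAt_variation
    (hζ : ζ = constPath E h - τ • backwardPrimitive E (momentum hV φ₀ (t, z)) -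
      t • backwardPrimitive E μ) {r : ℝ} (hr : r ∈ Icc (0 : ℝ) 1) :
    HasDerivWithinAt (fun r => ζ (clamp r))
      (τ • momentum hV φ₀ (t, z) (clamp r) + t • μ (clamp r)) (Icc 0 1) r := by
  have := (((hasDerivWithinAt_backwardPrimitive (momentum hV φ₀ (t, z)) hr).const_smul τ).const_sub
    h).sub ((hasDerivWithinAt_backwardPrimitive μ hr).const_smul t)
  rw [smul_neg, smul_neg, neg_neg, sub_neg_eq_add] at this
  refine this.congr_of_mem (fun u _ => ?_) hr
  rw [hζ]
  rfl

/-- The first variation of the action integral. Along a solution of Hamilton's equations, the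
integrand is the derivative of `⟨ξ, ζ⟩ - τ r (½|ξ|² + V)`. -/
lemma first_variation (hz : z = constPath E x + displacement hV φ₀ t z)
    (hζ : ζ = constPath E h - τ • backwardPrimitive E (momentum hV φ₀ (t, z)) -
      t • backwardPrimitive E μ) (Λ : C(I, ℝ))
    (hΛ : ∀ s : I, Λ s = inner ℝ (momentum hV φ₀ (t, z) s) (μ s) -
      fderiv ℝ (fun p : ℝ × E => V p.1 p.2) (t * s, z s) (τ * s, ζ s)) :
    inner ℝ (∇ φ₀ (z 0)) (ζ 0) + τ * primitive ℝ (lagrangian hV φ₀ (t, z)) 1 +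
        t * primitive ℝ Λ 1 =
      inner ℝ (momentum hV φ₀ (t, z) 1) h -
        τ * (1 / 2 * ‖momentum hV φ₀ (t, z) 1‖ ^ 2 + V t x) := by
  set ξ := momentum hV φ₀ (t, z) with hξ
  have key := primitive_one_eq_sub (τ • lagrangian hV φ₀ (t, z) + t • Λ)
    (g := fun r => inner ℝ (ξ (clamp r)) (ζ (clamp r)) -
      τ * (r * (1 / 2 * ‖ξ (clamp r)‖ ^ 2 + V (t * r) (z (clamp r))))) (fun r hr => by
    have dξ := hasDerivWithinAt_momentum (hV := hV) (φ₀ := φ₀) (t := t) (z := z) hr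
    have dz := hasDerivWithinAt_path hz hr
    have dζ := hasDerivWithinAt_variation hζ hr
    have dt : HasDerivWithinAt (fun r => t * r) t (Icc 0 1) r := by
      simpa using (hasDerivWithinAt_id r (Icc (0 : ℝ) 1)).const_mul t
    have dV := ((hV.differentiable (by simp) (t * r, z (clamp r))).hasFDerivAt).comp_hasDerivWithinAt
      r (dt.prodMk dz)
    have dK := (hasFDerivAt_kinetic (ξ (clamp r))).comp_hasDerivWithinAt r dξ
    have := (dξ.inner ℝ dζ).sub
      (((hasDerivWithinAt_id r (Icc (0 : ℝ) 1)).mul (dK.add dV)).const_mul τ)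
    refine this.congr_deriv ?_
    have hc : ((clamp r : I) : ℝ) = r := by rw [clamp_of_mem hr]
    have e2 := fderiv_apply_eq hV (t * r, z (clamp r)) t (t • ξ (clamp r))
    have e3 := fderiv_apply_eq hV (t * r, z (clamp r)) (τ * r) (ζ (clamp r))
    simp only [ContinuousMap.add_apply, ContinuousMap.smul_apply, hΛ, lagrangian_apply, hc, e2, e3,
      Function.comp_apply, innerSL_apply_apply, inner_add_right, inner_smul_left,
      inner_smul_right, smul_eq_mul, ← hξ, id, real_inner_self_eq_norm_sq, Pi.add_apply]
    have e1 := real_inner_comm (spatialGradient V (t * r, z (clamp r))) (ξ (clamp r))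
    simp only [e1, RCLike.conj_to_real]
    ring)
  have c1 : clamp 1 = (1 : I) := clamp_coe 1
  have c0 : clamp 0 = (0 : I) := clamp_coe 0
  have z1 : z 1 = x := by
    conv_lhs => rw [hz]
    simp [displacement]
  have ζ1 : ζ 1 = h := by rw [hζ]; simp
  have ξ0 : ξ 0 = ∇ φ₀ (z 0) := by simp [hξ, momentum]
  simp only [map_add, map_smul, ContinuousMap.add_apply, ContinuousMap.smul_apply, smul_eq_mul, c1,
    c0, z1, ζ1, ξ0, mul_one, one_mul, zero_mul, mul_zero, sub_zero] at key
  linarith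

end FirstVariation

lemma IsShortTime.fderiv_phase_apply (hT : IsShortTime hV φ₀ T) (hφ : ContDiff ℝ ∞ φ₀) {p : ℝ × E}
    (hp : |p.1| < T) (τ : ℝ) (h : E) :
    fderiv ℝ (phase hV φ₀) p (τ, h) =
      inner ℝ (momentum hV φ₀ (p.1, ray hV φ₀ p) 1) h -
        τ * (1 / 2 * ‖momentum hV φ₀ (p.1, ray hV φ₀ p) 1‖ ^ 2 + V p.1 p.2) := by
  set z := ray hV φ₀ p with hz
  have dray := ((hT.contDiffAt_ray hφ hp).differentiableAt (by simp)).hasFDerivAt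
  have dq : HasFDerivAt (fun p => (p.1, ray hV φ₀ p))
      ((ContinuousLinearMap.fst ℝ ℝ E).prod (fderiv ℝ (ray hV φ₀) p)) p :=
    hasFDerivAt_fst.prodMk dray
  have dm := ((contDiff_momentum hV hφ).differentiable (by simp) (p.1, z)).hasFDerivAt
  have dmp := dm.comp p dq
  have dL := ((contDiff_lagrangian (hV := hV) hφ).differentiable (by simp) (p.1, z)).hasFDerivAt
  have dLp := dL.comp p dq
  set ζ := fderiv ℝ (ray hV φ₀) p (τ, h) with hζ
  have eζ : ζ = constPath E h - τ • backwardPrimitive E (momentum hV φ₀ (p.1, z)) -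
      p.1 • backwardPrimitive E (fderiv ℝ (momentum hV φ₀) (p.1, z) (τ, ζ)) := by
    have d0 : HasFDerivAt (fun p : ℝ × E => displacement hV φ₀ p.1 (ray hV φ₀ p)) _ p :=
      (hasFDerivAt_fst (𝕜 := ℝ) (p := p)).neg.smul
        ((backwardPrimitive E).hasFDerivAt.comp p dmp)
    have d1 := ((constPath E).hasFDerivAt.comp p hasFDerivAt_snd).add d0
    have d2 := d1.congr_of_eventuallyEq (f₁ := ray hV φ₀)
      ((eventually_abs_fst_lt p hp).mono fun q hq => hT.ray_eq hφ hq)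
    have := congrArg (fun L => L (τ, h)) d2.fderiv
    simp only [← hζ] at this
    refine this.trans ?_
    simp [← hζ, ← hz, sub_eq_add_neg]
    abel
  have dP : HasFDerivAt (phase hV φ₀) _ p :=
    (((hφ.differentiable (by simp) (z 0)).hasFDerivAt.comp p
      ((evalPath (E := E) 0).hasFDerivAt.comp p dray))).add
      (hasFDerivAt_fst.mul (((evalPath (E := ℝ) 1).comp (primitive ℝ)).hasFDerivAt.comp p dLp))
  rw [dP.fderiv, ← first_variation (hT.ray_eq hφ hp) eζ
    (fderiv ℝ (lagrangian hV φ₀) (p.1, z) (τ, ζ)) (fun s => fderiv_lagrangian_apply hφ _ _ s)]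
  simp [← hζ, ← hz, fderiv_eq_inner_gradient, -inner_gradient_left]
  ring

end Action

/-! ### The phase of the rays -/

section Phase

open Set unitInterval

variable {E : Type} [NormedAddCommGroup E] [InnerProductSpace ℝ E] [CompleteSpace E]
  {V : ℝ → E → ℝ} {φ₀ : E → ℝ} {hV : ContDiff ℝ ∞ (fun p : ℝ × E => V p.1 p.2)} {T : ℝ}

lemma IsShortTime.contDiffAt_phase (hT : IsShortTime hV φ₀ T) (hφ : ContDiff ℝ ∞ φ₀) {p : ℝ × E}
    (hp : |p.1| < T) : ContDiffAt ℝ ∞ (phase hV φ₀) p :=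
  (contDiff_action hφ).contDiffAt.comp p (contDiffAt_fst.prodMk (hT.contDiffAt_ray hφ hp))

lemma IsShortTime.gradient_phase (hT : IsShortTime hV φ₀ T) (hφ : ContDiff ℝ ∞ φ₀) {t : ℝ}
    (ht : |t| < T) (x : E) :
    ∇ (fun x => phase hV φ₀ (t, x)) x = momentum hV φ₀ (t, ray hV φ₀ (t, x)) 1 := by
  refine ext_inner_right ℝ fun v => ?_
  have h1 := ((hT.contDiffAt_phase hφ (p := (t, x)) ht).differentiableAt (by simp)).hasFDerivAt.comp
    x (hasFDerivAt_prodMk_right t x)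
  have h2 : fderiv ℝ (fun x => phase hV φ₀ (t, x)) x = _ := h1.fderiv
  rw [← fderiv_eq_inner_gradient, h2]
  simpa using hT.fderiv_phase_apply hφ (p := (t, x)) ht 0 v

lemma IsShortTime.hasDerivAt_phase (hT : IsShortTime hV φ₀ T) (hφ : ContDiff ℝ ∞ φ₀) {t : ℝ}
    (ht : |t| < T) (x : E) :
    HasDerivAt (fun s => phase hV φ₀ (s, x))
      (-(1 / 2 * ‖∇ (fun x => phase hV φ₀ (t, x)) x‖ ^ 2 + V t x)) t := by
  have h1 := ((hT.contDiffAt_phase hφ (p := (t, x)) ht).differentiableAt (by simp)).hasFDerivAt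
  have h2 : HasDerivAt (fun s : ℝ => (s, x)) ((1 : ℝ), (0 : E)) t :=
    (hasDerivAt_id t).prodMk (hasDerivAt_const t x)
  refine (h1.comp_hasDerivAt t h2).congr_deriv ?_
  rw [hT.fderiv_phase_apply hφ (p := (t, x)) ht, hT.gradient_phase hφ ht]
  simp

lemma IsShortTime.phase_zero (hT : IsShortTime hV φ₀ T) (hT0 : 0 < T) (hφ : ContDiff ℝ ∞ φ₀)
    (x : E) : phase hV φ₀ (0, x) = φ₀ x := by
  have h := hT.ray_eq hφ (p := (0, x)) (by simpa using hT0)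
  have h0 : ray hV φ₀ (0, x) 0 = x := by
    rw [h]
    simp [displacement]
  simp [phase, action, h0]

/-- The phase is subquadratic, because its gradient is the final momentum of the ray, and rays
depend on their endpoint with bounded derivatives. -/
lemma IsShortTime.exists_norm_iteratedFDeriv_phase_le (hT : IsShortTime hV φ₀ T) (hT1 : T ≤ 1)
    (hVb : ∀ k, 2 ≤ k → ∃ C : ℝ, ∀ t ∈ Icc (-1 : ℝ) 1, ∀ x, ‖iteratedFDeriv ℝ k (V t) x‖ ≤ C)
    (hφ : ContDiff ℝ ∞ φ₀)
    (hφb : ∀ k, 2 ≤ k → ∃ C : ℝ, ∀ x, ‖iteratedFDeriv ℝ k φ₀ x‖ ≤ C) {k : ℕ} (hk : 2 ≤ k) :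
    ∃ C : ℝ, ∀ t, |t| < T → ∀ x, ‖iteratedFDeriv ℝ k (fun x => phase hV φ₀ (t, x)) x‖ ≤ C := by
  let j : {t : ℝ // |t| < T} → Icc (-1 : ℝ) 1 := fun t => ⟨t, abs_le.1 (t.2.le.trans hT1)⟩
  have hm : ∀ N, BoundedDerivs N
      (fun (t : {t : ℝ // |t| < T}) z => momentum hV φ₀ ((t : ℝ), z)) := fun N =>
    ⟨fun t => (boundedDerivs_momentum hV hVb hφ hφb N).1 (j t), fun k h1 h2 =>
      ((boundedDerivs_momentum hV hVb hφ hφb N).2 k h1 h2).imp fun C hC t => hC (j t)⟩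
  have hd : ∀ N, BoundedDerivs N
      (fun (t : {t : ℝ // |t| < T}) z => displacement hV φ₀ (t : ℝ) z) := fun N =>
    ⟨fun t => (boundedDerivs_displacement hV hVb hφ hφb N).1 (j t), fun k h1 h2 =>
      ((boundedDerivs_displacement hV hVb hφ hφb N).2 k h1 h2).imp fun C hC t => hC (j t)⟩
  have hr : ∀ N, BoundedDerivs N
      (fun (t : {t : ℝ // |t| < T}) x => ray hV φ₀ ((t : ℝ), x)) := fun N =>
    boundedDerivs_fixedPoint hd (fun t => hT t t.2) (constPath E)
      (fun t => contDiff_iff_contDiffAt.2 fun x =>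
        (hT.contDiffAt_ray hφ (p := ((t : ℝ), x)) t.2).comp x
          (contDiff_prodMk_right (t : ℝ)).contDiffAt)
      (fun t x => hT.ray_eq hφ (p := ((t : ℝ), x)) t.2) N
  have he : ∀ N, BoundedDerivs N (fun (_ : {t : ℝ // |t| < T}) (z : C(I, E)) => evalPath 1 z) :=
    fun N => boundedDerivs_clm N (fun _ => evalPath (E := E) 1) fun _ => norm_evalPath_le 1
  obtain ⟨m, rfl⟩ := Nat.exists_eq_add_of_le' (show 1 ≤ k by omega)
  obtain ⟨C, hC⟩ := ((he m).comp ((hm m).comp (hr m))).2 m (by omega) le_rfl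
  refine ⟨C, fun t ht x => ?_⟩
  rw [← norm_iteratedFDeriv_gradient,
    show ∇ (fun x => phase hV φ₀ (t, x)) = fun x => evalPath 1 (momentum hV φ₀ (t, ray hV φ₀ (t, x)))
      from funext fun x => hT.gradient_phase hφ ht x]
  exact hC ⟨t, ht⟩ x

end Phase

/-! ### Uniqueness -/

section Uniqueness

open Set unitInterval

variable {E : Type} [NormedAddCommGroup E] [InnerProductSpace ℝ E] [CompleteSpace E]
  {V : ℝ → E → ℝ} {φ₀ : E → ℝ} {hV : ContDiff ℝ ∞ (fun p : ℝ × E => V p.1 p.2)} {T : ℝ}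

variable (E) in
/-- The spatial gradient vector of a linear form on space-time. -/
noncomputable def spatialPart : (ℝ × E →L[ℝ] ℝ) →L[ℝ] E :=
  LinearMap.mkContinuous
    { toFun := fun L : ℝ × E →L[ℝ] ℝ => (InnerProductSpace.toDual ℝ E).symm (L.comp (.inr ℝ ℝ E))
      map_add' := fun _ _ => by rw [ContinuousLinearMap.add_comp, map_add]
      map_smul' := fun c L => by
        rw [ContinuousLinearMap.smul_comp, LinearIsometryEquiv.map_smulₛₗ]
        rfl } 1
    (fun L : ℝ × E →L[ℝ] ℝ => by
      refine ((InnerProductSpace.toDual ℝ E).symm.norm_map _).trans_le ?_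
      rw [one_mul]
      exact (L.opNorm_comp_le _).trans
        (mul_le_of_le_one_right (norm_nonneg _) (ContinuousLinearMap.norm_inr_le_one ℝ ℝ E)))

lemma inner_spatialPart (L : ℝ × E →L[ℝ] ℝ) (v : E) : inner ℝ (spatialPart E L) v = L (0, v) :=
  InnerProductSpace.toDual_symm_apply (𝕜 := ℝ) (y := L.comp (.inr ℝ ℝ E)) (x := v)

set_option maxSynthPendingDepth 3 in
/-- A smooth solution of the eikonal equation coincides with the action along the classical path.
The difference between its gradient and the momentum solves a linear ordinary differential equation
along the path, hence vanishes; no growth assumption on the solution is needed. -/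
lemma eq_action_of_eikonal (hT : 0 < T) {ψ : ℝ → E → ℝ}
    (hψ : ContDiffOn ℝ ∞ (fun p : ℝ × E => ψ p.1 p.2) (Icc 0 T ×ˢ univ))
    (heq : ∀ t ∈ Icc 0 T, ∀ x,
      derivWithin (fun s => ψ s x) (Icc 0 T) t + 1 / 2 * ‖∇ (ψ t) x‖ ^ 2 + V t x = 0)
    (hinit : ∀ x, ψ 0 x = φ₀ x) {t : ℝ} (ht : t ∈ Icc 0 T) {x : E} {z : C(I, E)}
    (hz : z = constPath E x + displacement hV φ₀ t z) :
    ψ t x = action hV φ₀ (t, z) := by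
  set Ψ : ℝ × E → ℝ := fun p => ψ p.1 p.2 with hΨ
  set S : Set (ℝ × E) := Icc 0 T ×ˢ univ with hS
  set D := fderivWithin ℝ Ψ S with hD
  set D2 := fderivWithin ℝ D S with hD2
  have hSu : UniqueDiffOn ℝ S := (uniqueDiffOn_Icc hT).prod uniqueDiffOn_univ
  have hDs : ContDiffOn ℝ ∞ D S := hψ.fderivWithin hSu (by simp)
  have hD2s : ContDiffOn ℝ ∞ D2 S := hDs.fderivWithin hSu (by simp)
  have dΨ : ∀ p ∈ S, HasFDerivWithinAt Ψ (D p) S p := fun p hp =>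
    ((hψ.differentiableOn (by simp)) p hp).hasFDerivWithinAt
  have dD : ∀ p ∈ S, HasFDerivWithinAt D (D2 p) S p := fun p hp =>
    ((hDs.differentiableOn (by simp)) p hp).hasFDerivWithinAt
  have hsymm : ∀ p ∈ S, ∀ v w, D2 p v w = D2 p w v := by
    intro p hp v w
    refine (hψ p hp).isSymmSndFDerivWithinAt
      (by simpa using WithTop.coe_le_coe.2 (le_top (a := (2 : ℕ∞)))) hSu ?_ hp v w
    rw [hS, interior_prod_eq, interior_Icc, interior_univ, closure_prod_eq, closure_Ioo hT.ne,
      closure_univ]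
    exact hp
  -- the gradient of the solution, as a vector field on the closed slab
  set N : ℝ × E → E := fun p => spatialPart E (D p) with hN
  have dN : ∀ p ∈ S, HasFDerivWithinAt N ((spatialPart E).comp (D2 p)) S p := fun p hp =>
    (spatialPart E).hasFDerivAt.comp_hasFDerivWithinAt p (dD p hp)
  have hgrad : ∀ p ∈ S, ∇ (ψ p.1) p.2 = N p := by
    intro p hp
    have h1 : HasFDerivWithinAt (ψ p.1) ((D p).comp (.inr ℝ ℝ E)) univ p.2 :=
      HasFDerivWithinAt.comp (f := fun y : E => (p.1, y)) (t := S) p.2 (dΨ p hp)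
        (hasFDerivAt_prodMk_right p.1 p.2).hasFDerivWithinAt (fun y _ => ⟨hp.1, mem_univ _⟩)
    rw [hasFDerivWithinAt_univ] at h1
    refine ext_inner_right ℝ fun v => ?_
    rw [hN, inner_spatialPart, ← fderiv_eq_inner_gradient, h1.fderiv]
    rfl
  have heqS : ∀ p ∈ S, D p (1, 0) + 1 / 2 * ‖N p‖ ^ 2 + V p.1 p.2 = 0 := by
    intro p hp
    have h1 : HasDerivWithinAt (fun s => ψ s p.2) (D p (1, 0)) (Icc 0 T) p.1 :=
      HasFDerivWithinAt.comp_hasDerivWithinAt (f := fun s : ℝ => (s, p.2)) (t := S) p.1 (dΨ p hp)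
        ((hasDerivWithinAt_id p.1 _).prodMk (hasDerivWithinAt_const p.1 _ p.2))
        (fun s hs => ⟨hs, mem_univ _⟩)
    rw [← heq p.1 hp.1 p.2, h1.derivWithin (uniqueDiffOn_Icc hT p.1 hp.1), hgrad p hp]
  -- the spatial derivative of the equation
  have hdeq : ∀ p ∈ S, ∀ v, D2 p (0, v) (1, 0) =
      -D2 p (0, v) (0, N p) - inner ℝ (spatialGradient V p) v := by
    intro p hp v
    have h1 := (((ContinuousLinearMap.apply ℝ ℝ ((1 : ℝ), (0 : E))).hasFDerivAt.comp_hasFDerivWithinAt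
      p (dD p hp)).add ((hasFDerivAt_kinetic (N p)).comp_hasFDerivWithinAt p (dN p hp))).add
      (hV.differentiable (by simp) p).hasFDerivAt.hasFDerivWithinAt
    have h2 := HasFDerivWithinAt.congr' (f₁ := fun _ => (0 : ℝ)) h1 (fun q hq => (heqS q hq).symm) hp
    have h3 := congrArg (fun L => L ((0 : ℝ), v))
      ((hSu p hp).eq h2 (hasFDerivWithinAt_const (0 : ℝ) p S))
    have h4 := fderiv_apply_eq hV p 0 v
    have h5 := inner_spatialPart (D2 p (0, v)) (N p)
    rw [real_inner_comm] at h5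
    simp at h3
    rw [h4, h5] at h3
    linarith
  -- the path in space-time
  set γ : ℝ → ℝ × E := fun r => (t * r, z (clamp r)) with hγ
  set ξ : ℝ → E := fun r => momentum hV φ₀ (t, z) (clamp r) with hξ
  have hγS : MapsTo γ (Icc 0 1) S := fun r hr =>
    ⟨⟨mul_nonneg ht.1 hr.1, (mul_le_of_le_one_right ht.1 hr.2).trans ht.2⟩, mem_univ _⟩
  have dγ : ∀ r ∈ Icc (0 : ℝ) 1, HasDerivWithinAt γ (t, t • ξ r) (Icc 0 1) r := by
    intro r hr
    have dt : HasDerivWithinAt (fun r => t * r) t (Icc 0 1) r := by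
      simpa using (hasDerivWithinAt_id r (Icc (0 : ℝ) 1)).const_mul t
    exact dt.prodMk (hasDerivWithinAt_path hz hr)
  -- the difference between gradient and momentum satisfies a linear differential equation
  set δ : ℝ → E := fun r => N (γ r) - ξ r with hδ
  have dδ : ∀ r ∈ Icc (0 : ℝ) 1, HasDerivWithinAt δ
      (-t • spatialPart E (D2 (γ r) (0, δ r))) (Icc 0 1) r := by
    intro r hr
    have hp := hγS hr
    refine (((dN _ hp).comp_hasDerivWithinAt r (dγ r hr) hγS).sub
      (hasDerivWithinAt_momentum hr)).congr_deriv ?_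
    refine ext_inner_right ℝ fun v => ?_
    have e1 : ((t, t • ξ r) : ℝ × E) = t • ((1, 0) : ℝ × E) + t • (0, ξ r) := by simp
    have e2 : ((0, δ r) : ℝ × E) = (0, N (γ r)) - (0, ξ r) := by simp [hδ]
    rw [inner_sub_left, inner_smul_left, inner_smul_left, ContinuousLinearMap.comp_apply,
      inner_spatialPart, inner_spatialPart, hsymm _ hp _ (0, v), hsymm _ hp (0, δ r) (0, v), e1, e2,
      map_add, map_smul, map_smul, map_sub, hdeq _ hp]
    simp only [smul_eq_mul, conj_trivial]
    ring
  have hδ0 : δ 0 = 0 := by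
    have h0 : ψ 0 = φ₀ := funext hinit
    have := hgrad (γ 0) (hγS (by simp))
    rw [hδ, sub_eq_zero, ← this]
    simp [hγ, hξ, h0, momentum]
  have hδz : ∀ r ∈ Icc (0 : ℝ) 1, δ r = 0 := by
    have hcont : ContinuousOn (fun r => D2 (γ r)) (Icc 0 1) :=
      hD2s.continuousOn.comp (fun r hr => (dγ r hr).continuousWithinAt) hγS
    obtain ⟨M, hM⟩ := isCompact_Icc.exists_bound_of_continuousOn hcont
    refine eq_zero_of_abs_deriv_le_mul_abs_self_of_eq_zero_right
      (K := |t| * (‖spatialPart E‖ * M))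
      (fun r hr => (dδ r hr).continuousWithinAt)
      (fun r hr => (dδ r (Ico_subset_Icc_self hr)).mono_of_mem_nhdsWithin (Icc_mem_nhdsGE_of_mem hr))
      hδ0 (fun r hr => ?_)
    have h1 : ‖D2 (γ r) (0, δ r)‖ ≤ M * ‖δ r‖ := by
      refine ((D2 (γ r)).le_of_opNorm_le (hM r (Ico_subset_Icc_self hr)) _).trans_eq ?_
      simp [Prod.norm_def]
    rw [norm_smul, norm_neg, Real.norm_eq_abs, mul_assoc, mul_assoc]
    gcongr
    exact (spatialPart E).le_opNorm_of_le h1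
  -- along the path, the solution grows at the rate of the Lagrangian
  have key := primitive_one_eq_sub (t • lagrangian hV φ₀ (t, z)) (g := fun r => Ψ (γ r))
    (fun r hr => by
      have hp := hγS hr
      refine ((dΨ _ hp).comp_hasDerivWithinAt r (dγ r hr) hγS).congr_deriv ?_
      have e1 : ((t, t • ξ r) : ℝ × E) = t • ((1, 0) : ℝ × E) + t • (0, ξ r) := by simp
      have e2 : N (γ r) = ξ r := sub_eq_zero.1 (hδz r hr)
      have e3 := inner_spatialPart (D (γ r)) (ξ r)
      have e4 : spatialPart E (D (γ r)) = ξ r := e2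
      have e5 := heqS _ hp
      rw [e4, real_inner_self_eq_norm_sq] at e3
      rw [e2] at e5
      have hc : ((clamp r : I) : ℝ) = r := by rw [clamp_of_mem hr]
      rw [e1, map_add, map_smul, map_smul, ← e3, ContinuousMap.smul_apply, lagrangian_apply, hc]
      simp only [smul_eq_mul]
      have e6 : V (γ r).1 (γ r).2 = V (t * r) (z (clamp r)) := rfl
      rw [e6] at e5
      have e7 : momentum hV φ₀ (t, z) (clamp r) = ξ r := rfl
      rw [e7]
      linear_combination t * e5)
  have c1 : clamp 1 = (1 : I) := clamp_coe 1
  have c0 : clamp 0 = (0 : I) := clamp_coe 0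
  have z1 : z 1 = x := by
    conv_lhs => rw [hz]
    simp [displacement]
  simp only [map_smul, ContinuousMap.smul_apply, smul_eq_mul, hΨ, hγ, c1, c0, z1, mul_one, mul_zero,
    hinit] at key
  rw [action]
  linarith

end Uniqueness

/-! ### The eikonal equation -/

theorem lemma1p1 (n : ℕ) (V : ℝ → EuclideanSpace ℝ (Fin n) → ℝ)
    (φ₀ : EuclideanSpace ℝ (Fin n) → ℝ) (h : GeometricAssumption V φ₀) :
    ∃ T : ℝ, 0 < T ∧
      ∃ φ : ℝ → EuclideanSpace ℝ (Fin n) → ℝ,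
        IsEikonalSolution V φ₀ T φ ∧
        (∀ ψ : ℝ → EuclideanSpace ℝ (Fin n) → ℝ, IsEikonalSolution V φ₀ T ψ →
          ∀ t ∈ Set.Icc 0 T, ∀ x, ψ t x = φ t x) ∧
        IsSubquadraticOn (Set.Icc 0 T) φ := by
  have hV := h.potential_smooth
  have hφ := h.phase_smooth
  have hVb := h.potential_subquadratic (Set.Icc (-1) 1) isCompact_Icc
  obtain ⟨T, hT0, hT1, hT⟩ := exists_isShortTime hV hVb hφ h.phase_subquadratic
  -- Rays are controlled on the open interval `|t| < T`, so the closed one has to be shorter.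
  have hT2 : 0 < T / 2 := half_pos hT0
  have habs : ∀ t ∈ Set.Icc 0 (T / 2), |t| < T := fun t ht => by
    rw [abs_of_nonneg ht.1]
    linarith [ht.2]
  refine ⟨T / 2, hT2, fun t x => phase hV φ₀ (t, x), ⟨?_, ?_, ?_⟩, ?_, ?_⟩
  · exact fun p hp => (hT.contDiffAt_phase hφ (p := p) (habs p.1 hp.1)).contDiffWithinAt
  · intro t ht x
    rw [(hT.hasDerivAt_phase hφ (habs t ht) x).hasDerivWithinAt.derivWithin
      (uniqueDiffOn_Icc hT2 t ht)]
    ring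
  · exact hT.phase_zero hT0 hφ
  · intro ψ hψ t ht x
    exact eq_action_of_eikonal hT2 hψ.smooth hψ.equation hψ.initial ht
      (hT.ray_eq hφ (p := (t, x)) (habs t ht))
  · intro k hk
    obtain ⟨C, hC⟩ := hT.exists_norm_iteratedFDeriv_phase_le hT1 hVb hφ h.phase_subquadratic hk
    exact ⟨C, fun t ht x => hC t (habs t ht) x⟩
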